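/- **A strengthened Mrs. Gerber's lemma.** *Notation.* For a real function $g$ on a finite set let $\mathbb{E}\, g$ be its average, and for $g\ge 0$ let $\mathrm{Ent}(g)=\mathbb{E}\,(g\log_2 g)-\mathbb{E}\, g\cdot\log_2 \mathbb{E}\, g$ (with $0\log_2 0=0$). For $0<\epsilon<1$ and $f:\{0,1\}^n\to\mathbb{R}$ let $$(T_\epsilon f)(x)=\sum_{y\in\{0,1\}^n}\epsilon^{|y-x|}(1-\epsilon)^{n-|y-x|}f(y),$$ where $|\cdot|$ is the Hamming distance. For $A\subseteq[n]$ let $\mathbb{E}(f\,|\,A)$ be the function on $\{0,1\}^n$ whose value at $x$ is the average of $f$ over all $y$ with $y_i=x_i$ for all $i\in A$, and let $\mathrm{Ent}(f\,|\,A)=\mathrm{Ent}(\mathbb{E}(f\,|\,A))$. For $x\in[0,1]$ let $\phi(x,\epsilon)=\mathrm{Ent}(T_\epsilon f_s)$, where $f_s:\{0,1\}\to\mathbb{R}$ is given by $f_s(0)=s$, $f_s(1)=2-s$, and $s\in[0,1]$ is chosen so that $\mathrm{Ent}(f_s)=x$. Let $H$ be the Shannon entropy in bits, $H_2(p)=-p\log_2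 p-(1-p)\log_2(1-p)$, and $H_2^{-1}:[0,1]\to[0,1/2]$ the inverse of $H_2$ on $[0,1/2]$. *Theorem.* Let $n\ge 0$ be an integer, let $0<\epsilon<1$, and let $t=(1-2\epsilon)^2 n$. Let $T$ be a random subset of $[n]$ that contains each $i\in[n]$ independently with probability $(1-2\epsilon)^2$. If $t=0$, the quotients by $t$ below (which are then $0/0$) are read as $0$. 1. For every $f:\{0,1\}^n\to[0,\infty)$ with $\mathbb{E}\, f=1$, the quotient $\mathbb{E}_T\,\mathrm{Ent}(f\,|\,T)/t$ lies in $[0,1]$, and $$\mathrm{Ent}(T_\epsilon f)\ \le\ n\cdot\phi\left(\frac{\mathbb{E}_T\,\mathrm{Ent}(f\,|\,T)}{t},\ \epsilon\right).$$ 2. In information-theoretic terms: let $X$ be a random vector with values in $\{0,1\}^n$, and let $Z$ be a noise vector independent of $X$ with $\Pr\{Z=z\}=\epsilon^{|z|}(1-\epsilon)^{n-|z|}$ for all $z\in\{0,1\}^n$, where $|z|$ is the Hamming weight. Then the quotient $\mathbb{E}_T\, H(\{X_i\}_{i\in T})/t$ lies in $[0,1]$ (where for each fixed value of $T$ the entropy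 is that of the vector $\{X_i\}_{i\in T}$), and $$H(X\oplus Z)\ \ge\ n\cdot H_2\left(\epsilon+(1-2\epsilon)\cdot H_2^{-1}\left(\frac{\mathbb{E}_T\, H(\{X_i\}_{i\in T})}{t}\right)\right).$$ -/

import Mathlib

open scoped BigOperators

namespace NoisyCube

/-! ### Functions on the Boolean cube -/

/-- The entropy functional of a function on a finite space with the uniform probability measure:
`Ent f = 𝔼 f log₂ f - 𝔼 f * log₂ (𝔼 f)`, with `0 log₂ 0 = 0`. -/
noncomputable def Ent {α : Type*} [Fintype α] (f : α → ℝ) : ℝ :=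
  (𝔼 x, f x * Real.logb 2 (f x)) - (𝔼 x, f x) * Real.logb 2 (𝔼 x, f x)

/-- The noise operator `T_ε` on functions on the cube `{0,1}ⁿ`:
`(T_ε f) x = ∑ y, ε ^ |y - x| * (1 - ε) ^ (n - |y - x|) * f y`, with the Hamming distance. -/
noncomputable def noise {n : ℕ} (ε : ℝ) (f : (Fin n → Bool) → ℝ) (x : Fin n → Bool) : ℝ :=
  ∑ y : Fin n → Bool, ε ^ hammingDist y x * (1 - ε) ^ (n - hammingDist y x) * f y

/-- The conditional expectation `𝔼(f | A) = 𝔼(f | {x_i}_{i ∈ A})` under the uniform measure, viewed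
as a function on the whole cube: at `x` it is the average of `f` over all points `y` that agree
with `x` on the coordinates in `A`. -/
noncomputable def condExpect {n : ℕ} (f : (Fin n → Bool) → ℝ) (A : Finset (Fin n))
    (x : Fin n → Bool) : ℝ :=
  𝔼 y : Fin n → Bool with ∀ i ∈ A, y i = x i, f y

/-- `Ent(f | A) = Ent(𝔼(f | A))`. -/
noncomputable def condEnt {n : ℕ} (f : (Fin n → Bool) → ℝ) (A : Finset (Fin n)) : ℝ :=
  Ent (condExpect f A)

/-- The expectation `𝔼_T g(T)`, where `T` is a random subset of `[n]` that contains each element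
independently with probability `l`. -/
noncomputable def expectSubset {n : ℕ} (l : ℝ) (g : Finset (Fin n) → ℝ) : ℝ :=
  ∑ A : Finset (Fin n), l ^ A.card * (1 - l) ^ (n - A.card) * g A

/-! ### Mrs. Gerber's function -/

/-- The function `f_t` on the two-point space `{0,1}` (the cube of dimension one), which is `t` at
zero and `2 - t` at one. -/
def twoPoint (t : ℝ) (x : Fin 1 → Bool) : ℝ :=
  if x 0 = false then t else 2 - t

/-- A `t` with `Ent f_t = x`, for `0 ≤ x ≤ 1`. Both `t` and `2 - t` are solutions, and the one in
`[0,1]` is chosen. -/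
noncomputable def twoPointParam (x : ℝ) : ℝ :=
  Function.invFunOn (fun t : ℝ => Ent (twoPoint t)) (Set.Icc 0 1) x

/-- Mrs. Gerber's function `φ(x, ε) = Ent (T_ε f_t)`, where `t` is such that `Ent f_t = x`. -/
noncomputable def phi (x ε : ℝ) : ℝ :=
  Ent (noise ε (twoPoint (twoPointParam x)))

/-! ### Shannon entropy, in bits -/

/-- The binary entropy function `H₂ x = - x log₂ x - (1 - x) log₂ (1 - x)`. -/
noncomputable def H₂ (x : ℝ) : ℝ :=
  -x * Real.logb 2 x - (1 - x) * Real.logb 2 (1 - x)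

/-- The inverse `H₂⁻¹ : [0,1] → [0,1/2]` of the binary entropy function. -/
noncomputable def H₂inv (y : ℝ) : ℝ :=
  Function.invFunOn H₂ (Set.Icc 0 (1 / 2)) y

/-- The Shannon entropy (in bits) of a random variable `X` with values in a finite set. -/
noncomputable def shannonEntropy {Ω α : Type*} [MeasurableSpace Ω] [Fintype α]
    (μ : MeasureTheory.Measure Ω) (X : Ω → α) : ℝ :=
  -∑ a : α, μ.real (X ⁻¹' {a}) * Real.logb 2 (μ.real (X ⁻¹' {a}))

/-- The random vector `Z` has the law of the noise of a binary symmetric channel with crossover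
probability `ε`: `Pr {Z = z} = ε ^ |z| * (1 - ε) ^ (n - |z|)`, with `|z|` the Hamming weight. -/
def HasNoiseLaw {Ω : Type*} [MeasurableSpace Ω] {n : ℕ} (μ : MeasureTheory.Measure Ω) (ε : ℝ)
    (Z : Ω → Fin n → Bool) : Prop :=
  ∀ z : Fin n → Bool, μ.real (Z ⁻¹' {z}) =
    ε ^ (Finset.univ.filter fun i => z i = true).card *
      (1 - ε) ^ (n - (Finset.univ.filter fun i => z i = true).card)

end NoisyCube

namespace NoisyCube
open Real Set

/-! ### Mrs. Gerber's lemma for the binary entropy function -/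

/-! Write `h` for binary entropy in nats, `λ = (1 - 2ε)²`, `N` for the output entropy of the
symmetric channel (`noisyEntropy`) and `E` for the mean entropy of the coordinates left by an
erasure channel that keeps each one with probability `λ` (`erasureEntropy`). Both parts of the
theorem are one bound of `N` from below in terms of `E`. It is proved by removing coordinates one at
a time, for arbitrary nonnegative weights, so that conditional laws need no normalization.

Two facts drive the induction. The first is Mrs. Gerber's lemma in the form of supporting lines
(`exists_support_line`): for each `s` in `[0, 1/2]` some `θ ≥ 0` makes `h(ε + (1 - 2ε)q) - λθ h(q)`
minimal at `q = s`. Averaged over posteriors (`noisyEntropy_gap_le`), it bounds the entropy of the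
first output bit, given the other outputs, from below by a constant plus `λθ` times the entropy of
the first input bit given these outputs.

The second is that erasure is the less noisy channel: `N - E` is subadditive
(`noisyEntropy_sub_erasureEntropy_add_le`). Hence the first input bit is at least as uncertain given
the noisy remainder as given the erased remainder. The latter conditional entropy, times `λ`, is
exactly the increment of `E` when the first coordinate is restored, so the sum telescopes in
`noisyEntropy_ge_of_support_line`. Choosing `s` with `E = λ n h(s)` cancels the terms in `θ`.

For functions, `f = 2ⁿ p` turns each `Ent` into the entropy deficit of a law, which reduces that
part to the same bound. -/

theorem negMulLog_add_sub_eq {a b : ℝ} (ha : 0 ≤ a) (hb : 0 ≤ b) :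
    negMulLog a + negMulLog b - negMulLog (a + b) = (a + b) * binEntropy (a / (a + b)) := by
  rcases (add_nonneg ha hb).eq_or_lt with h | h
  · have ha0 : a = 0 := by linarith
    have hb0 : b = 0 := by linarith
    simp [ha0, hb0]
  · have hM : a + b ≠ 0 := h.ne'
    have e1 : 1 - a / (a + b) = b / (a + b) := by field_simp; ring
    have ea : negMulLog a = (a / (a + b)) * negMulLog (a + b)
        + (a + b) * negMulLog (a / (a + b)) := by
      rw [← negMulLog_mul]; congr 1; field_simp
    have eb : negMulLog b = (b / (a + b)) * negMulLog (a + b)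
        + (a + b) * negMulLog (b / (a + b)) := by
      rw [← negMulLog_mul]; congr 1; field_simp
    rw [binEntropy_eq_negMulLog_add_negMulLog_one_sub, e1, ea, eb]
    field_simp
    ring

theorem bsc_mem_Ioo {ε x : ℝ} (h0 : 0 < ε) (h1 : ε < 1) (hx : x ∈ Icc (0 : ℝ) 1) :
    ε + (1 - 2 * ε) * x ∈ Ioo (0 : ℝ) 1 := by
  obtain ⟨hx0, hx1⟩ := hx
  constructor
  · rcases hx1.eq_or_lt with h | h
    · subst h; linarith
    · nlinarith [mul_pos h0 (sub_pos.2 h), mul_nonneg (sub_pos.2 h1).le hx0]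
  · rcases hx1.eq_or_lt with h | h
    · subst h; linarith
    · nlinarith [mul_pos (sub_pos.2 h1) (sub_pos.2 h), mul_nonneg h0.le hx0]

theorem hasDerivAt_binEntropy_bsc {ε x : ℝ} (θ : ℝ) (h0 : 0 < ε) (h1 : ε < 1)
    (hx : x ∈ Ioo (0 : ℝ) 1) :
    HasDerivAt (fun x => binEntropy (ε + (1 - 2 * ε) * x) - θ * binEntropy x)
      ((1 - 2 * ε) * (log (1 - (ε + (1 - 2 * ε) * x)) - log (ε + (1 - 2 * ε) * x))
        - θ * (log (1 - x) - log x)) x := by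
  have hw := bsc_mem_Ioo h0 h1 (Ioo_subset_Icc_self hx)
  have d1 := hasDerivAt_binEntropy hw.1.ne' hw.2.ne
  have d2 := hasDerivAt_binEntropy hx.1.ne' hx.2.ne
  have d3 : HasDerivAt (fun x : ℝ => ε + (1 - 2 * ε) * x) (1 - 2 * ε) x := by
    simpa using ((hasDerivAt_id x).const_mul (1 - 2 * ε)).const_add ε
  have d := (d1.comp x d3).sub (d2.const_mul θ)
  refine d.congr_deriv ?_
  ring

/-- With `w = ε + (1 - 2ε)x`, the second derivative is `(1 - 2ε)²` times `1/(x(1-x)) - 1/(w(1-w))`.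
It is nonnegative because the channel moves `x` toward `1/2`. This convexity is what makes `(1 -
2ε)²` the right survival probability for the erasure channel. -/
theorem convexOn_binEntropy_bsc {ε : ℝ} (h0 : 0 < ε) (h1 : ε < 1) :
    ConvexOn ℝ (Icc (0 : ℝ) 1)
      (fun x => binEntropy (ε + (1 - 2 * ε) * x) - (1 - 2 * ε) ^ 2 * binEntropy x) := by
  refine convexOn_of_hasDerivWithinAt2_nonneg (convex_Icc 0 1)
    (f' := fun x => (1 - 2 * ε) * (log (1 - (ε + (1 - 2 * ε) * x)) - log (ε + (1 - 2 * ε) * x))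
        - (1 - 2 * ε) ^ 2 * (log (1 - x) - log x))
    (f'' := fun x => (1 - 2 * ε) * (-(1 - 2 * ε) / (1 - (ε + (1 - 2 * ε) * x))
        - (1 - 2 * ε) / (ε + (1 - 2 * ε) * x))
        - (1 - 2 * ε) ^ 2 * (-1 / (1 - x) - 1 / x)) (by fun_prop) ?_ ?_ ?_
  · intro x hx
    rw [interior_Icc] at hx ⊢
    exact (hasDerivAt_binEntropy_bsc _ h0 h1 hx).hasDerivWithinAt
  · intro x hx
    rw [interior_Icc] at hx ⊢
    have hw := bsc_mem_Ioo h0 h1 (Ioo_subset_Icc_self hx)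
    have d3 : HasDerivAt (fun x : ℝ => ε + (1 - 2 * ε) * x) (1 - 2 * ε) x := by
      simpa using ((hasDerivAt_id x).const_mul (1 - 2 * ε)).const_add ε
    refine HasDerivAt.hasDerivWithinAt ?_
    refine HasDerivAt.sub (HasDerivAt.const_mul _ (HasDerivAt.sub ?_ ?_))
      (HasDerivAt.const_mul _ (HasDerivAt.sub ?_ ?_))
    · exact (d3.const_sub 1).log (by linarith [hw.2])
    · exact d3.log hw.1.ne'
    · exact ((hasDerivAt_id x).const_sub 1).log (sub_pos.2 hx.2).ne'
    · exact (hasDerivAt_id x).log hx.1.ne'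
  · intro x hx
    rw [interior_Icc] at hx
    have hw := bsc_mem_Ioo h0 h1 (Ioo_subset_Icc_self hx)
    obtain ⟨hx0, hx1⟩ := hx
    set w := ε + (1 - 2 * ε) * x with hwdef
    have hw0 := hw.1
    have hw1 := hw.2
    have e : (1 - 2 * ε) * (-(1 - 2 * ε) / (1 - w) - (1 - 2 * ε) / w)
        - (1 - 2 * ε) ^ 2 * (-1 / (1 - x) - 1 / x)
        = (1 - 2 * ε) ^ 2 * (1 / (x * (1 - x)) - 1 / (w * (1 - w))) := by
      have := (sub_pos.2 hx1).ne'
      have := (sub_pos.2 hw1).ne'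
      field_simp
      ring
    rw [e]
    refine mul_nonneg (sq_nonneg _) (sub_nonneg.2 ?_)
    refine one_div_le_one_div_of_le (mul_pos hx0 (sub_pos.2 hx1)) ?_
    have : w * (1 - w) - x * (1 - x) = ε * (1 - ε) * (1 - 2 * x) ^ 2 := by rw [hwdef]; ring
    have : 0 ≤ ε * (1 - ε) * (1 - 2 * x) ^ 2 :=
      mul_nonneg (mul_nonneg h0.le (sub_pos.2 h1).le) (sq_nonneg _)
    linarith

/-! ### Monotonicity of the ratio of the entropy derivatives -/

theorem hasDerivAt_log_sub_log {x : ℝ} (hx : x ∈ Ioo (0 : ℝ) 1) :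
    HasDerivAt (fun x => log (1 + x) - log (1 - x)) (2 / (1 - x ^ 2)) x := by
  obtain ⟨hx0, hx1⟩ := hx
  have h1 : (1 - x) ≠ 0 := (sub_pos.2 hx1).ne'
  have h2 : (1 + x) ≠ 0 := by positivity
  have h3 : 1 - x ^ 2 ≠ 0 := by
    have : 1 - x ^ 2 = (1 - x) * (1 + x) := by ring
    rw [this]; exact mul_ne_zero h1 h2
  have d1 := ((hasDerivAt_id x).const_add 1).log h2
  have d2 := ((hasDerivAt_id x).const_sub 1).log h1
  refine (d1.sub d2).congr_deriv ?_
  simp only [id]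
  field_simp
  ring

theorem two_mul_le_log_sub_log {x : ℝ} (hx : x ∈ Ioo (0 : ℝ) 1) :
    2 * x ≤ log (1 + x) - log (1 - x) := by
  obtain ⟨hx0, hx1⟩ := hx
  have h := hasSum_log_sub_log_of_abs_lt_one (x := x) (by rw [abs_of_pos hx0]; exact hx1)
  -- The power series has nonnegative terms, and its first term is `2 * x`.
  have := h.summable.sum_le_tsum (Finset.range 1) (fun i _ => by positivity)
  rw [h.tsum_eq] at this
  simpa using this

theorem antitoneOn_log_sub_log_div :
    AntitoneOn (fun x : ℝ => (1 - x ^ 2) * (log (1 + x) - log (1 - x)) / x) (Ioo 0 1) := by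
  have hd : ∀ x ∈ Ioo (0 : ℝ) 1, HasDerivAt
      (fun x : ℝ => (1 - x ^ 2) * (log (1 + x) - log (1 - x)) / x)
      (((-(2 * x) * (log (1 + x) - log (1 - x)) + (1 - x ^ 2) * (2 / (1 - x ^ 2))) * x
        - (1 - x ^ 2) * (log (1 + x) - log (1 - x)) * 1) / x ^ 2) x := by
    intro x hx
    have d1 : HasDerivAt (fun x : ℝ => 1 - x ^ 2) (-(2 * x)) x := by
      simpa using (hasDerivAt_pow 2 x).const_sub 1
    exact (d1.mul (hasDerivAt_log_sub_log hx)).div (hasDerivAt_id x) hx.1.ne'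
  refine antitoneOn_of_hasDerivWithinAt_nonpos (convex_Ioo 0 1)
    (fun x hx => (hd x hx).continuousAt.continuousWithinAt)
    (fun x hx => (hd x (interior_subset hx)).hasDerivWithinAt) ?_
  intro x hx
  have hx' := interior_subset hx
  have h2 := two_mul_le_log_sub_log hx'
  obtain ⟨hx0, hx1⟩ := hx'
  have h3 : 1 - x ^ 2 ≠ 0 := by nlinarith
  refine div_nonpos_of_nonpos_of_nonneg ?_ (sq_nonneg x)
  rw [mul_div_cancel₀ _ h3]
  nlinarith [mul_nonneg (sq_nonneg x) (sub_nonneg.2 h2)]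

/-- With `F x = log (1 + x) - log (1 - x)`, the sign of the derivative of `F(rx)/F(x)` is decided by
comparing `yF'(y)/F(y)` at `y = rx` and at `y = x`. This quantity is `2y/((1 - y²)F(y))`, which
increases by `antitoneOn_log_sub_log_div`. -/
theorem antitoneOn_log_sub_log_ratio {r : ℝ} (hr : r ∈ Ioo (0 : ℝ) 1) :
    AntitoneOn (fun x : ℝ => (log (1 + r * x) - log (1 - r * x)) / (log (1 + x) - log (1 - x)))
      (Ioo 0 1) := by
  have hrx : ∀ x ∈ Ioo (0 : ℝ) 1, r * x ∈ Ioo (0 : ℝ) 1 := fun x hx =>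
    ⟨mul_pos hr.1 hx.1, mul_lt_one_of_nonneg_of_lt_one_left hr.1.le hr.2 hx.2.le⟩
  have hpos : ∀ x ∈ Ioo (0 : ℝ) 1, 0 < log (1 + x) - log (1 - x) := fun x hx =>
    lt_of_lt_of_le (by linarith [hx.1]) (two_mul_le_log_sub_log hx)
  have hd : ∀ x ∈ Ioo (0 : ℝ) 1, HasDerivAt
      (fun x : ℝ => (log (1 + r * x) - log (1 - r * x)) / (log (1 + x) - log (1 - x)))
      ((2 / (1 - (r * x) ^ 2) * r * (log (1 + x) - log (1 - x))
        - (log (1 + r * x) - log (1 - r * x)) * (2 / (1 - x ^ 2)))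
        / (log (1 + x) - log (1 - x)) ^ 2) x := by
    intro x hx
    have d1 : HasDerivAt (fun x : ℝ => r * x) r x := by
      simpa using (hasDerivAt_id x).const_mul r
    have d2 := (hasDerivAt_log_sub_log (hrx x hx)).comp x d1
    exact d2.div (hasDerivAt_log_sub_log hx) (hpos x hx).ne'
  refine antitoneOn_of_hasDerivWithinAt_nonpos (convex_Ioo 0 1)
    (fun x hx => (hd x hx).continuousAt.continuousWithinAt)
    (fun x hx => (hd x (interior_subset hx)).hasDerivWithinAt) ?_
  intro x hx
  have hx' := interior_subset hx
  have hy := hrx x hx'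
  have hle : r * x ≤ x := by nlinarith [hx'.1, hr.2]
  have key := antitoneOn_log_sub_log_div hy hx' hle
  simp only at key
  have hx0 := hx'.1
  have h3 : 0 < 1 - x ^ 2 := by nlinarith [hx'.2]
  have h4 : 0 < 1 - (r * x) ^ 2 := by nlinarith [hy.2, hy.1]
  refine div_nonpos_of_nonpos_of_nonneg ?_ (sq_nonneg _)
  rw [div_le_div_iff₀ hx0 hy.1] at key
  have e : 2 / (1 - (r * x) ^ 2) * r * (log (1 + x) - log (1 - x))
        - (log (1 + r * x) - log (1 - r * x)) * (2 / (1 - x ^ 2))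
      = 2 / ((1 - (r * x) ^ 2) * (1 - x ^ 2) * x) *
        ((1 - x ^ 2) * (log (1 + x) - log (1 - x)) * (r * x)
        - (1 - (r * x) ^ 2) * (log (1 + r * x) - log (1 - r * x)) * x) := by
    have := h3.ne'
    have := h4.ne'
    rw [mul_assoc, div_mul_eq_mul_div, mul_div_assoc', div_sub_div _ _ h4.ne' h3.ne',
      div_mul_eq_mul_div, div_eq_div_iff (by positivity) (by positivity)]
    ring
  rw [e]
  exact mul_nonpos_of_nonneg_of_nonpos (by positivity) (by linarith)

theorem binEntropy_bsc_one_sub (ε x : ℝ) :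
    binEntropy (ε + (1 - 2 * ε) * (1 - x)) = binEntropy (ε + (1 - 2 * ε) * x) := by
  rw [← binEntropy_one_sub]; congr 1; ring

theorem binEntropy_bsc_symm (ε x : ℝ) :
    binEntropy ((1 - ε) + (1 - 2 * (1 - ε)) * x) = binEntropy (ε + (1 - 2 * ε) * x) := by
  rw [← binEntropy_one_sub]; congr 1; ring

/-- Mrs. Gerber's lemma as the existence of supporting lines, for a crossover probability below
one half and arguments in `[0, 1/2]`. -/
theorem exists_support_line_of_lt_half {ε : ℝ} (h0 : 0 < ε) (h1 : ε < 1 / 2) {p : ℝ}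
    (hp : p ∈ Icc (0 : ℝ) (1 / 2)) :
    ∃ θ : ℝ, 0 ≤ θ ∧ ∀ q ∈ Icc (0 : ℝ) (1 / 2),
      binEntropy (ε + (1 - 2 * ε) * p) - θ * binEntropy p ≤
        binEntropy (ε + (1 - 2 * ε) * q) - θ * binEntropy q := by
  have h1' : ε < 1 := by linarith
  have hr : 1 - 2 * ε ∈ Ioo (0 : ℝ) 1 := ⟨by linarith, by linarith⟩
  rcases hp.1.eq_or_lt with hp0 | hp0
  -- At `p = 0` the derivative of `binEntropy` is infinite, so the slope ratio tends to zero; `θ =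
  -- 0` works since the output entropy is least at `q = 0`.
  · refine ⟨0, le_rfl, fun q hq => ?_⟩
    subst hp0
    simp only [zero_mul, sub_zero, mul_zero, add_zero]
    refine binEntropy_strictMonoOn.monotoneOn ⟨h0.le, by linarith⟩ ⟨?_, ?_⟩ ?_ <;>
      nlinarith [hq.1, hq.2, hr.1, mul_nonneg hr.1.le hq.1]
  rcases hp.2.eq_or_lt with hp2 | hp2
  -- At `p = 1/2` both derivatives vanish and `(1 - 2ε)²` is the limit of their ratio. Minimality is
  -- midpoint convexity for `q` and `1 - q`, where the function takes equal values.
  · refine ⟨(1 - 2 * ε) ^ 2, sq_nonneg _, fun q hq => ?_⟩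
    have hq1 : q ∈ Icc (0 : ℝ) 1 := ⟨hq.1, by linarith [hq.2]⟩
    have hq2 : 1 - q ∈ Icc (0 : ℝ) 1 := ⟨by linarith [hq.2], by linarith [hq.1]⟩
    obtain ⟨-, hc⟩ := convexOn_binEntropy_bsc h0 h1'
    replace hc := hc hq1 hq2 (a := 1 / 2) (b := 1 / 2) (by norm_num) (by norm_num) (by norm_num)
    have e : (1 / 2 : ℝ) • q + (1 / 2 : ℝ) • (1 - q) = p := by
      simp only [smul_eq_mul]; linarith
    rw [e] at hc
    simp only [smul_eq_mul, binEntropy_bsc_one_sub, binEntropy_one_sub] at hc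
    linarith
  set r := 1 - 2 * ε with hrdef
  let F : ℝ → ℝ := fun x => log (1 + x) - log (1 - x)
  have hF : ∀ x ∈ Ioo (0 : ℝ) 1, 0 < F x := fun x hx =>
    lt_of_lt_of_le (by linarith [hx.1]) (two_mul_le_log_sub_log hx)
  have hm : ∀ q ∈ Ioo (0 : ℝ) (1 / 2), 1 - 2 * q ∈ Ioo (0 : ℝ) 1 := fun q hq =>
    ⟨by linarith [hq.2], by linarith [hq.1]⟩
  have hrm : ∀ x ∈ Ioo (0 : ℝ) 1, r * x ∈ Ioo (0 : ℝ) 1 := fun x hx =>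
    ⟨mul_pos hr.1 hx.1, mul_lt_one_of_nonneg_of_lt_one_left hr.1.le hr.2 hx.2.le⟩
  let ρ : ℝ → ℝ := fun q => F (r * (1 - 2 * q)) / F (1 - 2 * q)
  have hρ : ∀ a ∈ Ioo (0 : ℝ) (1 / 2), ∀ b ∈ Ioo (0 : ℝ) (1 / 2), a ≤ b → ρ a ≤ ρ b :=
    fun a ha b hb hab =>
      antitoneOn_log_sub_log_ratio hr (hm b hb) (hm a ha) (by linarith)
  have hpI : p ∈ Ioo (0 : ℝ) (1 / 2) := ⟨hp0, hp2⟩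
  have hL : ∀ x ∈ Ioo (0 : ℝ) 1, log (1 - x) - log x = F (1 - 2 * x) := by
    intro x hx
    have e1 : 1 + (1 - 2 * x) = 2 * (1 - x) := by ring
    have e2 : 1 - (1 - 2 * x) = 2 * x := by ring
    simp only [F, e1, e2]
    rw [log_mul two_ne_zero (sub_pos.2 hx.2).ne', log_mul two_ne_zero hx.1.ne']
    ring
  -- The ratio of the two derivatives at `p`, so that `p` is a critical point. As `ρ` increases, the
  -- derivative passes from nonpositive to nonnegative there.
  let θ := r * ρ p
  have hder : ∀ q ∈ Ioo (0 : ℝ) (1 / 2),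
      HasDerivAt (fun x => binEntropy (ε + r * x) - θ * binEntropy x)
        (r * F (1 - 2 * q) * (ρ q - ρ p)) q := by
    intro q hq
    have hq1 : q ∈ Ioo (0 : ℝ) 1 := ⟨hq.1, by linarith [hq.2]⟩
    have d := hasDerivAt_binEntropy_bsc θ h0 h1' hq1
    rw [hL q hq1, hL _ (bsc_mem_Ioo h0 h1' (Ioo_subset_Icc_self hq1))] at d
    convert d using 1
    have e : 1 - 2 * (ε + (1 - 2 * ε) * q) = r * (1 - 2 * q) := by rw [hrdef]; ring
    have hne := (hF _ (hm q hq)).ne'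
    rw [e, mul_sub, show r * F (1 - 2 * q) * ρ q = r * F (r * (1 - 2 * q)) by
      simp only [ρ]; field_simp]
    simp only [θ]
    ring
  refine ⟨θ, mul_nonneg hr.1.le (div_pos (hF _ (hrm _ (hm p hpI))) (hF _ (hm p hpI))).le, ?_⟩
  intro q hq
  have hcont : Continuous (fun x => binEntropy (ε + r * x) - θ * binEntropy x) := by fun_prop
  rcases le_total q p with hqp | hqp
  · have hanti : AntitoneOn (fun x => binEntropy (ε + r * x) - θ * binEntropy x) (Icc 0 p) := by
      refine antitoneOn_of_hasDerivWithinAt_nonpos (convex_Icc 0 p) hcont.continuousOn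
        (f' := fun q => r * F (1 - 2 * q) * (ρ q - ρ p)) ?_ ?_
      · intro x hx
        rw [interior_Icc] at hx
        exact (hder x ⟨hx.1, hx.2.trans hp2⟩).hasDerivWithinAt
      · intro x hx
        rw [interior_Icc] at hx
        have hxI : x ∈ Ioo (0 : ℝ) (1 / 2) := ⟨hx.1, hx.2.trans hp2⟩
        exact mul_nonpos_of_nonneg_of_nonpos (mul_nonneg hr.1.le (hF _ (hm x hxI)).le)
          (sub_nonpos.2 (hρ x hxI p hpI hx.2.le))
    exact hanti ⟨hq.1, hqp⟩ ⟨hp0.le, le_rfl⟩ hqp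
  · have hmono : MonotoneOn (fun x => binEntropy (ε + r * x) - θ * binEntropy x)
        (Icc p (1 / 2)) := by
      refine monotoneOn_of_hasDerivWithinAt_nonneg (convex_Icc p (1 / 2)) hcont.continuousOn
        (f' := fun q => r * F (1 - 2 * q) * (ρ q - ρ p)) ?_ ?_
      · intro x hx
        rw [interior_Icc] at hx
        exact (hder x ⟨hp0.trans hx.1, hx.2⟩).hasDerivWithinAt
      · intro x hx
        rw [interior_Icc] at hx
        have hxI : x ∈ Ioo (0 : ℝ) (1 / 2) := ⟨hp0.trans hx.1, hx.2⟩
        exact mul_nonneg (mul_nonneg hr.1.le (hF _ (hm x hxI)).le)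
          (sub_nonneg.2 (hρ p hpI x hxI hx.1.le))
    exact hmono ⟨le_rfl, hp2.le⟩ ⟨hqp, hq.2⟩ hqp

/-- Mrs. Gerber's lemma as the existence of supporting lines. -/
theorem exists_support_line {ε : ℝ} (h0 : 0 < ε) (h1 : ε < 1) {p : ℝ}
    (hp : p ∈ Icc (0 : ℝ) (1 / 2)) :
    ∃ θ : ℝ, 0 ≤ θ ∧ ∀ q ∈ Icc (0 : ℝ) 1,
      binEntropy (ε + (1 - 2 * ε) * p) - (1 - 2 * ε) ^ 2 * θ * binEntropy p ≤
        binEntropy (ε + (1 - 2 * ε) * q) - (1 - 2 * ε) ^ 2 * θ * binEntropy q := by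
  rcases eq_or_ne ε (1 / 2) with he | he
  -- At `ε = 1/2` the output bit is uniform whatever `q` is, and the division by `(1 - 2ε)²` below
  -- would be illegitimate.
  · refine ⟨0, le_rfl, fun q _ => ?_⟩
    simp [he]
  have hl : 0 < (1 - 2 * ε) ^ 2 := by
    have : 1 - 2 * ε ≠ 0 := fun h => he (by linarith)
    positivity
  have hhalf : ∃ θ : ℝ, 0 ≤ θ ∧ ∀ q ∈ Icc (0 : ℝ) (1 / 2),
      binEntropy (ε + (1 - 2 * ε) * p) - θ * binEntropy p ≤
        binEntropy (ε + (1 - 2 * ε) * q) - θ * binEntropy q := by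
    rcases he.lt_or_gt with he | he
    · exact exists_support_line_of_lt_half h0 he hp
    · obtain ⟨θ, hθ, h⟩ := exists_support_line_of_lt_half (ε := 1 - ε)
        (by linarith) (by linarith) hp
      simp only [binEntropy_bsc_symm] at h
      exact ⟨θ, hθ, h⟩
  obtain ⟨θ, hθ, h⟩ := hhalf
  -- The slope is rescaled to match the factor `(1 - 2ε)²` carried by each increment of the erasure
  -- entropy.
  refine ⟨θ / (1 - 2 * ε) ^ 2, by positivity, fun q hq => ?_⟩
  rw [mul_div_cancel₀ _ hl.ne']
  rcases le_total q (1 / 2) with hq2 | hq2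
  · exact h q ⟨hq.1, hq2⟩
  · have := h (1 - q) ⟨by linarith [hq.2], by linarith⟩
    rwa [binEntropy_bsc_one_sub, binEntropy_one_sub] at this

/-! ### Slices of the cube -/

/-- The restriction of a function on the cube to the face where the first coordinate is `b`. -/
def slice {n : ℕ} (p : (Fin (n + 1) → Bool) → ℝ) (b : Bool) (y : Fin n → Bool) : ℝ :=
  p (Fin.cons b y)

theorem slice_linear {n : ℕ} (a c : ℝ) (p q : (Fin (n + 1) → Bool) → ℝ) (b : Bool) :
    slice (a • p + c • q) b = a • slice p b + c • slice q b := rfl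

theorem slice_add {n : ℕ} (p q : (Fin (n + 1) → Bool) → ℝ) (b : Bool) :
    slice (p + q) b = slice p b + slice q b := rfl

theorem slice_nonneg {n : ℕ} {p : (Fin (n + 1) → Bool) → ℝ} (hp : 0 ≤ p) (b : Bool) :
    0 ≤ slice p b := fun y => hp (Fin.cons b y)

theorem sum_cube_succ {n : ℕ} (F : (Fin (n + 1) → Bool) → ℝ) :
    ∑ x, F x = ∑ y, slice F false y + ∑ y, slice F true y := by
  rw [← (Fin.consEquiv (fun _ : Fin (n + 1) => Bool)).sum_comp, Fintype.sum_prod_type,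
    Fintype.sum_bool, add_comm]
  rfl

theorem sum_cube_zero (F : (Fin 0 → Bool) → ℝ) : ∑ x, F x = F fun _ => false := by
  rw [Fintype.sum_unique]
  exact congrArg F (Subsingleton.elim _ _)

/-! ### Averages over random subsets -/

theorem expectSubset_succ {n : ℕ} (l : ℝ) (g : Finset (Fin (n + 1)) → ℝ) :
    expectSubset l g =
      l * expectSubset l (fun T => g (insert 0 (T.map (Fin.succEmb n)))) +
        (1 - l) * expectSubset l (fun T => g (T.map (Fin.succEmb n))) := by
  have h0 : (0 : Fin (n + 1)) ∉ (Finset.univ : Finset (Fin n)).map (Fin.succEmb n) := by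
    simp [Fin.succ_ne_zero]
  have h0' : ∀ T : Finset (Fin n), (0 : Fin (n + 1)) ∉ T.map (Fin.succEmb n) := by
    simp [Fin.succ_ne_zero]
  have hmap : ∀ G : Finset (Fin (n + 1)) → ℝ,
      ∑ A ∈ ((Finset.univ : Finset (Fin n)).map (Fin.succEmb n)).powerset, G A =
        ∑ T : Finset (Fin n), G (T.map (Fin.succEmb n)) := by
    intro G
    symm
    refine Finset.sum_bij (fun T _ => T.map (Fin.succEmb n)) ?_ ?_ ?_ (fun _ _ => rfl)
    · intro T _
      rw [Finset.mem_powerset]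
      exact Finset.map_subset_map.2 (Finset.subset_univ T)
    · intro T _ T' _ h
      exact Finset.map_injective _ h
    · intro A hA
      obtain ⟨u, -, hu⟩ := Finset.subset_map_iff.1 (Finset.mem_powerset.1 hA)
      exact ⟨u, Finset.mem_univ _, hu.symm⟩
  have huniv : (Finset.univ : Finset (Fin (n + 1))) =
      insert 0 ((Finset.univ : Finset (Fin n)).map (Fin.succEmb n)) := by
    ext i
    refine Fin.cases ?_ (fun j => ?_) i <;> simp
  unfold expectSubset
  rw [← Finset.powerset_univ, huniv, Finset.sum_powerset_insert h0, hmap, hmap, add_comm,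
    Finset.mul_sum, Finset.mul_sum]
  congr 1 <;> refine Finset.sum_congr rfl fun T _ => ?_
  · rw [Finset.card_insert_of_notMem (h0' T), Finset.card_map, Nat.add_sub_add_right]
    ring
  -- The bound `T.card ≤ n` keeps the truncated subtraction honest: the exponent grows by exactly
  -- one.
  · rw [Finset.card_map, Nat.sub_add_comm (by simpa using Finset.card_le_univ T)]
    ring

theorem expectSubset_zero (l : ℝ) (g : Finset (Fin 0) → ℝ) : expectSubset l g = g ∅ := by
  unfold expectSubset
  rw [Fintype.sum_unique, Subsingleton.elim (default : Finset (Fin 0)) ∅]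
  simp

theorem expectSubset_add {n : ℕ} (l : ℝ) (g h : Finset (Fin n) → ℝ) :
    expectSubset l (fun T => g T + h T) = expectSubset l g + expectSubset l h := by
  simp only [expectSubset, mul_add, Finset.sum_add_distrib]

theorem expectSubset_const_mul {n : ℕ} (l c : ℝ) (g : Finset (Fin n) → ℝ) :
    expectSubset l (fun T => c * g T) = c * expectSubset l g := by
  simp only [expectSubset, Finset.mul_sum]
  exact Finset.sum_congr rfl fun T _ => by ring

theorem expectSubset_one {n : ℕ} (l : ℝ) : expectSubset (n := n) l (fun _ => 1) = 1 := by
  induction n with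
  | zero => simp [expectSubset_zero]
  | succ n ih => rw [expectSubset_succ, ih]; ring

theorem expectSubset_card {n : ℕ} (l : ℝ) :
    expectSubset (n := n) l (fun T => (T.card : ℝ)) = l * n := by
  induction n with
  | zero => simp [expectSubset_zero]
  | succ n ih =>
    have h0' : ∀ T : Finset (Fin n), (0 : Fin (n + 1)) ∉ T.map (Fin.succEmb n) := by
      simp [Fin.succ_ne_zero]
    rw [expectSubset_succ]
    simp only [Finset.card_insert_of_notMem (h0' _), Finset.card_map, Nat.cast_add, Nat.cast_one]
    rw [expectSubset_add, expectSubset_one, ih]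
    ring

/-! ### Entropies of the output of an erasure channel and of a symmetric channel -/

/-- The total weight of the points that agree with `x` on `T`. -/
def marginal {n : ℕ} (p : (Fin n → Bool) → ℝ) (T : Finset (Fin n)) (x : Fin n → Bool) : ℝ :=
  ∑ y : Fin n → Bool with ∀ i ∈ T, y i = x i, p y

/-- The entropy in nats of the marginal of `p` on the coordinates in `T`. -/
noncomputable def marginalEntropy {n : ℕ} (p : (Fin n → Bool) → ℝ) (T : Finset (Fin n)) : ℝ :=
  2 ^ T.card / 2 ^ n * ∑ x, negMulLog (marginal p T x)

/-- The average entropy of the marginals of `p` on the random set of unerased coordinates. -/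
noncomputable def erasureEntropy {n : ℕ} (l : ℝ) (p : (Fin n → Bool) → ℝ) : ℝ :=
  expectSubset l (marginalEntropy p)

/-- The entropy of the output of the binary symmetric channel with input `p`. -/
noncomputable def noisyEntropy {n : ℕ} (ε : ℝ) (p : (Fin n → Bool) → ℝ) : ℝ :=
  ∑ x, negMulLog (noise ε p x)

/-! ### Recursions in the first coordinate -/

theorem marginal_map_succ {n : ℕ} (p : (Fin (n + 1) → Bool) → ℝ) (T : Finset (Fin n)) (b : Bool)
    (x : Fin n → Bool) :
    marginal p (T.map (Fin.succEmb n)) (Fin.cons b x) =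
      marginal (slice p false + slice p true) T x := by
  simp only [marginal, Finset.sum_filter]
  rw [sum_cube_succ, ← Finset.sum_add_distrib]
  refine Finset.sum_congr rfl fun y _ => ?_
  simp only [slice, Finset.mem_map, forall_exists_index, and_imp, forall_apply_eq_imp_iff₂,
    Fin.coe_succEmb, Fin.cons_succ, Pi.add_apply]
  split_ifs <;> simp

theorem marginal_insert_zero {n : ℕ} (p : (Fin (n + 1) → Bool) → ℝ) (T : Finset (Fin n))
    (b : Bool) (x : Fin n → Bool) :
    marginal p (insert 0 (T.map (Fin.succEmb n))) (Fin.cons b x) = marginal (slice p b) T x := by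
  simp only [marginal, Finset.sum_filter]
  rw [sum_cube_succ, ← Finset.sum_add_distrib]
  refine Finset.sum_congr rfl fun y _ => ?_
  simp only [slice, Finset.mem_map, forall_exists_index, and_imp, forall_apply_eq_imp_iff₂,
    Fin.coe_succEmb, Fin.cons_succ, Finset.forall_mem_insert, Fin.cons_zero]
  cases b <;> simp

/-- An unobserved first bit merges the two slices. Both faces of the cube then give the same sum,
and the doubling is absorbed by the prefactor `2 ^ T.card / 2 ^ n`, which compensates for repeated
values of the marginal. -/
theorem marginalEntropy_map_succ {n : ℕ} (p : (Fin (n + 1) → Bool) → ℝ) (T : Finset (Fin n)) :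
    marginalEntropy p (T.map (Fin.succEmb n)) =
      marginalEntropy (slice p false + slice p true) T := by
  unfold marginalEntropy
  rw [sum_cube_succ]
  simp only [slice, marginal_map_succ, Finset.card_map]
  rw [pow_succ]
  field_simp
  ring

theorem marginalEntropy_insert_zero {n : ℕ} (p : (Fin (n + 1) → Bool) → ℝ)
    (T : Finset (Fin n)) :
    marginalEntropy p (insert 0 (T.map (Fin.succEmb n))) =
      marginalEntropy (slice p false) T + marginalEntropy (slice p true) T := by
  have h0' : (0 : Fin (n + 1)) ∉ T.map (Fin.succEmb n) := by
    simp [Fin.succ_ne_zero]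
  unfold marginalEntropy
  rw [sum_cube_succ, Finset.card_insert_of_notMem h0', Finset.card_map]
  simp only [slice, marginal_insert_zero]
  rw [pow_succ, pow_succ]
  field_simp

/-- With probability `l` the first bit survives and separates the slices; otherwise they are merged.
-/
theorem erasureEntropy_succ {n : ℕ} (l : ℝ) (p : (Fin (n + 1) → Bool) → ℝ) :
    erasureEntropy l p =
      l * (erasureEntropy l (slice p false) + erasureEntropy l (slice p true)) +
        (1 - l) * erasureEntropy l (slice p false + slice p true) := by
  unfold erasureEntropy
  rw [expectSubset_succ]
  simp only [marginalEntropy_insert_zero, marginalEntropy_map_succ]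
  rw [expectSubset_add]

theorem erasureEntropy_zero (l : ℝ) (p : (Fin 0 → Bool) → ℝ) :
    erasureEntropy l p = negMulLog (p fun _ => false) := by
  rw [erasureEntropy, expectSubset_zero, marginalEntropy, sum_cube_zero, marginal,
    Finset.sum_filter, sum_cube_zero]
  simp

theorem noise_eq_sum_prod {n : ℕ} (ε : ℝ) (p : (Fin n → Bool) → ℝ) (x : Fin n → Bool) :
    noise ε p x = ∑ y, (∏ i, if y i = x i then 1 - ε else ε) * p y := by
  unfold noise
  refine Finset.sum_congr rfl fun y _ => ?_
  congr 1
  rw [Finset.prod_ite, Finset.prod_const, Finset.prod_const, mul_comm]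
  have hc := Finset.card_filter_add_card_filter_not (s := (Finset.univ : Finset (Fin n)))
    (fun i => y i = x i)
  rw [Finset.card_univ, Fintype.card_fin] at hc
  have hd : hammingDist y x = (Finset.univ.filter fun i => ¬ y i = x i).card := rfl
  rw [hd, ← Nat.eq_sub_of_add_eq hc]

theorem noise_linear {n : ℕ} (ε a c : ℝ) (p q : (Fin n → Bool) → ℝ) (x : Fin n → Bool) :
    noise ε (a • p + c • q) x = a * noise ε p x + c * noise ε q x := by
  unfold noise
  rw [Finset.mul_sum, Finset.mul_sum, ← Finset.sum_add_distrib]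
  refine Finset.sum_congr rfl fun y _ => ?_
  simp only [Pi.add_apply, Pi.smul_apply, smul_eq_mul]
  ring

theorem noise_cons {n : ℕ} (ε : ℝ) (p : (Fin (n + 1) → Bool) → ℝ) (b : Bool)
    (x : Fin n → Bool) :
    noise ε p (Fin.cons b x) = noise ε ((1 - ε) • slice p b + ε • slice p (!b)) x := by
  rw [noise_linear]
  simp only [noise_eq_sum_prod]
  rw [sum_cube_succ, Finset.mul_sum, Finset.mul_sum]
  cases b
  · simp only [slice, Fin.prod_univ_succ, Fin.cons_zero, Fin.cons_succ, Bool.not_false, mul_assoc,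
      if_true, reduceCtorEq, if_false]
  · rw [add_comm]
    simp only [slice, Fin.prod_univ_succ, Fin.cons_zero, Fin.cons_succ, Bool.not_true, mul_assoc,
      if_true, reduceCtorEq, if_false]

theorem noisyEntropy_succ {n : ℕ} (ε : ℝ) (p : (Fin (n + 1) → Bool) → ℝ) :
    noisyEntropy ε p = noisyEntropy ε ((1 - ε) • slice p false + ε • slice p true) +
      noisyEntropy ε (ε • slice p false + (1 - ε) • slice p true) := by
  unfold noisyEntropy
  rw [sum_cube_succ]
  simp only [slice, noise_cons]
  rw [add_comm (ε • _)]
  rfl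

theorem noisyEntropy_zero (ε : ℝ) (p : (Fin 0 → Bool) → ℝ) :
    noisyEntropy ε p = negMulLog (p fun _ => false) := by
  rw [noisyEntropy, sum_cube_zero, noise, sum_cube_zero]
  simp

theorem noise_nonneg {n : ℕ} {ε : ℝ} (h0 : 0 < ε) (h1 : ε < 1) {p : (Fin n → Bool) → ℝ}
    (hp : 0 ≤ p) (x : Fin n → Bool) : 0 ≤ noise ε p x :=
  Finset.sum_nonneg fun y _ =>
    mul_nonneg (mul_nonneg (pow_nonneg h0.le _) (pow_nonneg (sub_pos.2 h1).le _)) (hp y)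

theorem sum_noise {n : ℕ} (ε : ℝ) (p : (Fin n → Bool) → ℝ) :
    ∑ x, noise ε p x = ∑ x, p x := by
  induction n with
  | zero => simp [noise]
  | succ n ih =>
    rw [sum_cube_succ, sum_cube_succ p]
    have hs : ∀ b, ∑ y, slice (noise ε p) b y =
        (1 - ε) * ∑ y, slice p b y + ε * ∑ y, slice p (!b) y := by
      intro b
      calc ∑ y, slice (noise ε p) b y
          = ∑ y, noise ε ((1 - ε) • slice p b + ε • slice p (!b)) y :=
            Finset.sum_congr rfl fun y _ => noise_cons ε p b y
        _ = _ := by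
          rw [ih, Finset.mul_sum, Finset.mul_sum, ← Finset.sum_add_distrib]
          rfl
    rw [hs, hs, Bool.not_false, Bool.not_true]
    ring

/-! ### Comparison of the two channels -/

/-- The grouping rule applied to the two output weights, whose total is still `a + b`: the excess is
the entropy of the output bit scaled by the mass. -/
theorem negMulLog_bsc_add_sub_eq {ε a b : ℝ} (h0 : 0 < ε) (h1 : ε < 1) (ha : 0 ≤ a)
    (hb : 0 ≤ b) :
    negMulLog ((1 - ε) * a + ε * b) + negMulLog (ε * a + (1 - ε) * b) - negMulLog (a + b) =
      (a + b) * binEntropy (ε + (1 - 2 * ε) * (a / (a + b))) := by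
  have h1' := (sub_pos.2 h1).le
  have h := negMulLog_add_sub_eq (a := (1 - ε) * a + ε * b) (b := ε * a + (1 - ε) * b)
    (by positivity) (by positivity)
  rw [show (1 - ε) * a + ε * b + (ε * a + (1 - ε) * b) = a + b by ring] at h
  rw [h]
  rcases (add_nonneg ha hb).eq_or_lt with hM | hM
  · simp [← hM]
  · congr 2
    field_simp
    ring

theorem div_add_mem_Icc {a b : ℝ} (ha : 0 ≤ a) (hb : 0 ≤ b) : a / (a + b) ∈ Icc (0 : ℝ) 1 :=
  ⟨by positivity, div_le_one_of_le₀ (by linarith) (by positivity)⟩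

/-- The gap between the output entropies of the symmetric channel and of the erasure channel for
an input bit with weights `a` and `b`, for an arbitrary entropy functional `h`. -/
def channelGap {V : Type*} [AddCommGroup V] [Module ℝ V] (ε : ℝ) (h : V → ℝ) (a b : V) : ℝ :=
  h ((1 - ε) • a + ε • b) + h (ε • a + (1 - ε) • b)
    - (1 - 2 * ε) ^ 2 * (h a + h b) - (1 - (1 - 2 * ε) ^ 2) * h (a + b)

theorem channelGap_negMulLog {ε a b : ℝ} (h0 : 0 < ε) (h1 : ε < 1) (ha : 0 ≤ a) (hb : 0 ≤ b) :
    channelGap ε negMulLog a b = (a + b) * (binEntropy (ε + (1 - 2 * ε) * (a / (a + b)))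
      - (1 - 2 * ε) ^ 2 * binEntropy (a / (a + b))) := by
  have e1 := negMulLog_bsc_add_sub_eq h0 h1 ha hb
  have e2 := negMulLog_add_sub_eq ha hb
  simp only [channelGap, smul_eq_mul]
  linear_combination e1 - (1 - 2 * ε) ^ 2 * e2

/-- The gap is the perspective of the convex function in `convexOn_binEntropy_bsc`, and perspectives
of convex functions are subadditive: Jensen is applied to the two posteriors with weights
proportional to the masses `a + b` and `c + d`. -/
theorem channelGap_negMulLog_add_le {ε a b c d : ℝ} (h0 : 0 < ε) (h1 : ε < 1) (ha : 0 ≤ a)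
    (hb : 0 ≤ b) (hc : 0 ≤ c) (hd : 0 ≤ d) :
    channelGap ε negMulLog (a + c) (b + d) ≤
      channelGap ε negMulLog a b + channelGap ε negMulLog c d := by
  rw [channelGap_negMulLog h0 h1 (add_nonneg ha hc) (add_nonneg hb hd),
    channelGap_negMulLog h0 h1 ha hb, channelGap_negMulLog h0 h1 hc hd]
  obtain ⟨-, hconv⟩ := convexOn_binEntropy_bsc h0 h1
  rcases (add_nonneg ha hb).eq_or_lt with hM | hM
  · have ha0 : a = 0 := by linarith
    have hb0 : b = 0 := by linarith
    simp [ha0, hb0]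
  rcases (add_nonneg hc hd).eq_or_lt with hN | hN
  · have hc0 : c = 0 := by linarith
    have hd0 : d = 0 := by linarith
    simp [hc0, hd0]
  have hS : 0 < a + b + (c + d) := add_pos hM hN
  have h := hconv (div_add_mem_Icc ha hb) (div_add_mem_Icc hc hd)
    (a := (a + b) / (a + b + (c + d))) (b := (c + d) / (a + b + (c + d)))
    (by positivity) (by positivity) (by field_simp)
  have e : ((a + b) / (a + b + (c + d))) • (a / (a + b)) +
      ((c + d) / (a + b + (c + d))) • (c / (c + d)) = (a + c) / (a + c + (b + d)) := by
    rw [show a + c + (b + d) = a + b + (c + d) by ring, smul_eq_mul, smul_eq_mul]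
    field_simp
  rw [e] at h
  have h' := mul_le_mul_of_nonneg_left h hS.le
  rw [show a + c + (b + d) = a + b + (c + d) by ring] at h' ⊢
  refine h'.trans_eq ?_
  simp only [smul_eq_mul]
  field_simp

theorem linear_nonneg {V : Type*} {ε : ℝ} (h0 : 0 < ε) (h1 : ε < 1) {p q : V → ℝ} (hp : 0 ≤ p)
    (hq : 0 ≤ q) : 0 ≤ (1 - ε) • p + ε • q ∧ 0 ≤ ε • p + (1 - ε) • q :=
  ⟨add_nonneg (smul_nonneg (sub_pos.2 h1).le hp) (smul_nonneg h0.le hq),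
    add_nonneg (smul_nonneg h0.le hp) (smul_nonneg (sub_pos.2 h1).le hq)⟩

theorem channelGap_erasureEntropy_succ {n : ℕ} (ε l : ℝ) (p q : (Fin (n + 1) → Bool) → ℝ) :
    channelGap ε (erasureEntropy l) p q =
      l * (channelGap ε (erasureEntropy l) (slice p false) (slice q false) +
          channelGap ε (erasureEntropy l) (slice p true) (slice q true)) +
        (1 - l) * channelGap ε (erasureEntropy l) (slice p false + slice p true)
          (slice q false + slice q true) := by
  have e : ∀ a b : ℝ, slice (a • p + b • q) false + slice (a • p + b • q) true =
      a • (slice p false + slice p true) + b • (slice q false + slice q true) := by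
    intro a b
    rw [slice_linear, slice_linear]
    module
  have e1 : slice (p + q) false + slice (p + q) true =
      slice p false + slice p true + (slice q false + slice q true) := by
    rw [slice_add, slice_add]
    abel
  unfold channelGap
  rw [erasureEntropy_succ l ((1 - ε) • p + ε • q), erasureEntropy_succ l (ε • p + (1 - ε) • q),
    erasureEntropy_succ l p, erasureEntropy_succ l q, erasureEntropy_succ l (p + q), e, e, e1]
  rw [slice_linear, slice_linear, slice_linear, slice_linear, slice_add, slice_add]
  ring

/-- `channelGap` is linear in the functional, so the recursion for the erasure entropy writes it as
a combination of gaps in one dimension less. The coefficients `l` and `1 - l` are nonnegative, so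
subadditivity passes up from the scalar case. -/
theorem channelGap_erasureEntropy_add_le {ε l : ℝ} (h0 : 0 < ε) (h1 : ε < 1)
    (hl : l ∈ Icc (0 : ℝ) 1) {n : ℕ} {p q p' q' : (Fin n → Bool) → ℝ}
    (hp : 0 ≤ p) (hq : 0 ≤ q) (hp' : 0 ≤ p') (hq' : 0 ≤ q') :
    channelGap ε (erasureEntropy l) (p + p') (q + q') ≤
      channelGap ε (erasureEntropy l) p q + channelGap ε (erasureEntropy l) p' q' := by
  induction n with
  | zero =>
    simp only [channelGap, erasureEntropy_zero]
    exact channelGap_negMulLog_add_le h0 h1 (hp _) (hq _) (hp' _) (hq' _)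
  | succ n ih =>
    rw [channelGap_erasureEntropy_succ, channelGap_erasureEntropy_succ ε l p q,
      channelGap_erasureEntropy_succ ε l p' q']
    have a0 := ih (slice_nonneg hp false) (slice_nonneg hq false) (slice_nonneg hp' false)
      (slice_nonneg hq' false)
    have a1 := ih (slice_nonneg hp true) (slice_nonneg hq true) (slice_nonneg hp' true)
      (slice_nonneg hq' true)
    have a2 := ih (add_nonneg (slice_nonneg hp false) (slice_nonneg hp true))
      (add_nonneg (slice_nonneg hq false) (slice_nonneg hq true))
      (add_nonneg (slice_nonneg hp' false) (slice_nonneg hp' true))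
      (add_nonneg (slice_nonneg hq' false) (slice_nonneg hq' true))
    have e : ∀ p p' : (Fin (n + 1) → Bool) → ℝ, slice (p + p') false + slice (p + p') true =
        slice p false + slice p true + (slice p' false + slice p' true) := by
      intro p p'
      rw [slice_add, slice_add]
      abel
    rw [e, e]
    simp only [slice_add]
    have b0 := mul_le_mul_of_nonneg_left (add_le_add a0 a1) hl.1
    have b1 := mul_le_mul_of_nonneg_left a2 (sub_nonneg.2 hl.2)
    linarith

/-- The binary symmetric channel is dominated by an erasure channel in the less noisy order: the
difference of the output entropies is a convex function of the input law. -/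
theorem noisyEntropy_sub_erasureEntropy_add_le {ε : ℝ} (h0 : 0 < ε) (h1 : ε < 1) {n : ℕ}
    {p q : (Fin n → Bool) → ℝ} (hp : 0 ≤ p) (hq : 0 ≤ q) :
    noisyEntropy ε (p + q) - erasureEntropy ((1 - 2 * ε) ^ 2) (p + q) ≤
      (noisyEntropy ε p - erasureEntropy ((1 - 2 * ε) ^ 2) p) +
        (noisyEntropy ε q - erasureEntropy ((1 - 2 * ε) ^ 2) q) := by
  have hl : (1 - 2 * ε) ^ 2 ∈ Icc (0 : ℝ) 1 := ⟨sq_nonneg _, by nlinarith⟩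
  induction n with
  | zero => simp [noisyEntropy_zero, erasureEntropy_zero]
  | succ n ih =>
    -- Channels are exchanged one coordinate at a time. The first two terms send the first bit
    -- through the symmetric channel and compare the channels on the rest. The last term is the cost
    -- of exchanging the channel of the first bit while the rest is subject to erasure.
    have key : ∀ p : (Fin (n + 1) → Bool) → ℝ,
        noisyEntropy ε p - erasureEntropy ((1 - 2 * ε) ^ 2) p =
          (noisyEntropy ε ((1 - ε) • slice p false + ε • slice p true) -
            erasureEntropy ((1 - 2 * ε) ^ 2) ((1 - ε) • slice p false + ε • slice p true)) +
          (noisyEntropy ε (ε • slice p false + (1 - ε) • slice p true) -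
            erasureEntropy ((1 - 2 * ε) ^ 2) (ε • slice p false + (1 - ε) • slice p true)) +
          channelGap ε (erasureEntropy ((1 - 2 * ε) ^ 2)) (slice p false) (slice p true) := by
      intro p
      rw [noisyEntropy_succ, erasureEntropy_succ, channelGap]
      ring
    rw [key, key p, key q]
    have hp' := linear_nonneg h0 h1 (slice_nonneg hp false) (slice_nonneg hp true)
    have hq' := linear_nonneg h0 h1 (slice_nonneg hq false) (slice_nonneg hq true)
    have a0 := ih hp'.1 hq'.1
    have a1 := ih hp'.2 hq'.2
    have a2 := channelGap_erasureEntropy_add_le h0 h1 hl (slice_nonneg hp false)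
      (slice_nonneg hp true) (slice_nonneg hq false) (slice_nonneg hq true)
    have e : ∀ a b : ℝ, a • slice (p + q) false + b • slice (p + q) true =
        a • slice p false + b • slice p true + (a • slice q false + b • slice q true) := by
      intro a b
      rw [slice_add, slice_add]
      module
    rw [e, e, slice_add, slice_add]
    linarith

/-! ### Range of the erasure entropy -/

/-- For total mass one this is the conditional entropy of the bit selecting `p` or `q`, given the
unerased coordinates, so it lies between zero and `log 2`. -/
theorem erasureEntropy_gap_mem {l : ℝ} (hl : l ∈ Icc (0 : ℝ) 1) {n : ℕ}
    {p q : (Fin n → Bool) → ℝ} (hp : 0 ≤ p) (hq : 0 ≤ q) :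
    erasureEntropy l p + erasureEntropy l q - erasureEntropy l (p + q) ∈
      Icc 0 (log 2 * (∑ x, p x + ∑ x, q x)) := by
  induction n with
  | zero =>
    simp only [erasureEntropy_zero, sum_cube_zero, Pi.add_apply]
    have h1 := hp fun _ => false
    have h2 := hq fun _ => false
    simp only [Pi.zero_apply] at h1 h2
    rw [negMulLog_add_sub_eq h1 h2, mul_comm (log 2)]
    have hI := div_add_mem_Icc h1 h2
    exact ⟨mul_nonneg (add_nonneg h1 h2) (binEntropy_nonneg hI.1 hI.2),
      mul_le_mul_of_nonneg_left binEntropy_le_log_two (add_nonneg h1 h2)⟩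
  | succ n ih =>
    have a0 := ih (slice_nonneg hp false) (slice_nonneg hq false)
    have a1 := ih (slice_nonneg hp true) (slice_nonneg hq true)
    have a2 := ih (add_nonneg (slice_nonneg hp false) (slice_nonneg hp true))
      (add_nonneg (slice_nonneg hq false) (slice_nonneg hq true))
    have e : slice (p + q) false + slice (p + q) true =
        slice p false + slice p true + (slice q false + slice q true) := by
      rw [slice_add, slice_add]
      abel
    rw [erasureEntropy_succ, erasureEntropy_succ l q, erasureEntropy_succ l (p + q), e,
      sum_cube_succ p, sum_cube_succ q]
    simp only [slice_add, Pi.add_apply, Finset.sum_add_distrib] at a2 ⊢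
    have hl0 := hl.1
    have hl1 := sub_nonneg.2 hl.2
    constructor
    · linarith [mul_nonneg hl0 a0.1, mul_nonneg hl0 a1.1, mul_nonneg hl1 a2.1]
    · linarith [mul_le_mul_of_nonneg_left a0.2 hl0, mul_le_mul_of_nonneg_left a1.2 hl0,
        mul_le_mul_of_nonneg_left a2.2 hl1]

theorem erasureEntropy_succ_eq_add_gap {n : ℕ} (l : ℝ) (p : (Fin (n + 1) → Bool) → ℝ) :
    erasureEntropy l p = erasureEntropy l (slice p false + slice p true) +
      l * (erasureEntropy l (slice p false) + erasureEntropy l (slice p true) -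
        erasureEntropy l (slice p false + slice p true)) := by
  rw [erasureEntropy_succ]
  ring

theorem sum_slice_add {n : ℕ} (p : (Fin (n + 1) → Bool) → ℝ) :
    ∑ y, (slice p false + slice p true) y = ∑ x, p x := by
  rw [sum_cube_succ p, ← Finset.sum_add_distrib]
  rfl

theorem erasureEntropy_sub_mem {l : ℝ} (hl : l ∈ Icc (0 : ℝ) 1) {n : ℕ}
    {p : (Fin n → Bool) → ℝ} (hp : 0 ≤ p) :
    erasureEntropy l p - negMulLog (∑ x, p x) ∈ Icc 0 (l * n * log 2 * ∑ x, p x) := by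
  induction n with
  | zero =>
    rw [erasureEntropy_zero, sum_cube_zero]
    simp
  | succ n ih =>
    have a := ih (add_nonneg (slice_nonneg hp false) (slice_nonneg hp true))
    have b := erasureEntropy_gap_mem hl (slice_nonneg hp false) (slice_nonneg hp true)
    rw [sum_slice_add] at a
    rw [← Finset.sum_add_distrib] at b
    have hb : ∑ x, (slice p false x + slice p true x) = ∑ x, p x := sum_slice_add p
    rw [hb] at b
    rw [erasureEntropy_succ_eq_add_gap]
    push_cast
    constructor
    · linarith [a.1, mul_nonneg hl.1 b.1]
    · linarith [a.2, mul_le_mul_of_nonneg_left b.2 hl.1]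

/-! ### Induction on the dimension -/

/-- For each output `x` of the remaining coordinates, the first bit has weights `noise ε p x` and
`noise ε q x`. The scalar bound `hc` is applied to the resulting posterior and summed against the
mass at `x`. -/
theorem noisyEntropy_gap_le {ε c θ : ℝ} (h0 : 0 < ε) (h1 : ε < 1)
    (hc : ∀ q ∈ Icc (0 : ℝ) 1, c ≤ binEntropy (ε + (1 - 2 * ε) * q) - θ * binEntropy q) {n : ℕ}
    {p q : (Fin n → Bool) → ℝ} (hp : 0 ≤ p) (hq : 0 ≤ q) :
    c * (∑ x, (p + q) x) + θ * (noisyEntropy ε p + noisyEntropy ε q - noisyEntropy ε (p + q)) ≤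
      noisyEntropy ε ((1 - ε) • p + ε • q) + noisyEntropy ε (ε • p + (1 - ε) • q)
        - noisyEntropy ε (p + q) := by
  have hadd : ∀ x, noise ε (p + q) x = noise ε p x + noise ε q x := by
    intro x
    have := noise_linear ε 1 1 p q x
    simpa using this
  rw [← sum_noise ε]
  simp only [noisyEntropy, noise_linear, hadd]
  rw [← Finset.sum_add_distrib, ← Finset.sum_sub_distrib, ← Finset.sum_add_distrib,
    ← Finset.sum_sub_distrib, Finset.mul_sum, Finset.mul_sum, ← Finset.sum_add_distrib]
  refine Finset.sum_le_sum fun x _ => ?_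
  have ha := noise_nonneg h0 h1 hp x
  have hb := noise_nonneg h0 h1 hq x
  rw [negMulLog_bsc_add_sub_eq h0 h1 ha hb, negMulLog_add_sub_eq ha hb]
  have := mul_le_mul_of_nonneg_left (hc _ (div_add_mem_Icc ha hb)) (add_nonneg ha hb)
  linarith

theorem noisyEntropy_ge_of_support_line {ε c θ : ℝ} (h0 : 0 < ε) (h1 : ε < 1) (hθ : 0 ≤ θ)
    (hc : ∀ q ∈ Icc (0 : ℝ) 1, c ≤ binEntropy (ε + (1 - 2 * ε) * q) -
      (1 - 2 * ε) ^ 2 * θ * binEntropy q) {n : ℕ} {p : (Fin n → Bool) → ℝ} (hp : 0 ≤ p) :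
    n * c * (∑ x, p x) + θ * (erasureEntropy ((1 - 2 * ε) ^ 2) p - negMulLog (∑ x, p x)) ≤
      noisyEntropy ε p - negMulLog (∑ x, p x) := by
  induction n with
  | zero =>
    rw [erasureEntropy_zero, noisyEntropy_zero, sum_cube_zero]
    simp
  | succ n ih =>
    have hs0 := slice_nonneg hp false
    have hs1 := slice_nonneg hp true
    have a := ih (add_nonneg hs0 hs1)
    have b := noisyEntropy_gap_le h0 h1 hc hs0 hs1
    have d := noisyEntropy_sub_erasureEntropy_add_le h0 h1 hs0 hs1
    rw [sum_slice_add] at a b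
    rw [erasureEntropy_succ_eq_add_gap, noisyEntropy_succ]
    push_cast
    -- The less noisy comparison replaces the conditional entropy of the first bit given noisy
    -- outputs by the one given erased outputs; `θ ≥ 0` preserves its direction.
    have := mul_le_mul_of_nonneg_left d (mul_nonneg (sq_nonneg (1 - 2 * ε)) hθ)
    linarith

/-- The strengthened Mrs. Gerber's lemma for a probability vector on the cube, in nats. -/
theorem noisyEntropy_ge {ε : ℝ} (h0 : 0 < ε) (h1 : ε < 1) {n : ℕ} {p : (Fin n → Bool) → ℝ}
    (hp : 0 ≤ p) (hsum : ∑ x, p x = 1) {s : ℝ} (hs : s ∈ Icc (0 : ℝ) (1 / 2))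
    (hA : erasureEntropy ((1 - 2 * ε) ^ 2) p = (1 - 2 * ε) ^ 2 * n * binEntropy s) :
    n * binEntropy (ε + (1 - 2 * ε) * s) ≤ noisyEntropy ε p := by
  obtain ⟨θ, hθ, hc⟩ := exists_support_line h0 h1 hs
  have h := noisyEntropy_ge_of_support_line h0 h1 hθ hc hp
  rw [hsum, hA, negMulLog_one] at h
  linarith

theorem erasureEntropy_mem {ε : ℝ} (h0 : 0 < ε) (h1 : ε < 1) {n : ℕ} {p : (Fin n → Bool) → ℝ}
    (hp : 0 ≤ p) (hsum : ∑ x, p x = 1) :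
    erasureEntropy ((1 - 2 * ε) ^ 2) p ∈ Icc 0 ((1 - 2 * ε) ^ 2 * n * log 2) := by
  have hl : (1 - 2 * ε) ^ 2 ∈ Icc (0 : ℝ) 1 := ⟨sq_nonneg _, by nlinarith⟩
  simpa [hsum] using erasureEntropy_sub_mem hl hp

/-! ### Translation to entropies in bits -/

theorem card_filter_agree {n : ℕ} (T : Finset (Fin n)) (x : Fin n → Bool) :
    (Finset.univ.filter fun y : Fin n → Bool => ∀ i ∈ T, y i = x i).card = 2 ^ (n - T.card) := by
  have h : (Finset.univ.filter fun y : Fin n → Bool => ∀ i ∈ T, y i = x i) =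
      Fintype.piFinset (fun i => if i ∈ T then {x i} else Finset.univ) := by
    ext y
    simp only [Finset.mem_filter, Finset.mem_univ, true_and, Fintype.mem_piFinset]
    refine forall_congr' fun i => ?_
    split_ifs with hi <;> simp [hi]
  rw [h, Fintype.card_piFinset]
  have h2 : ∀ i, (if i ∈ T then {x i} else (Finset.univ : Finset Bool)).card =
      if i ∈ T then 1 else 2 := by
    intro i
    split_ifs <;> simp
  simp only [h2]
  rw [Finset.prod_ite, Finset.prod_const_one, Finset.prod_const, one_mul]
  congr 1
  have : (Finset.univ.filter fun i => i ∉ T) = Tᶜ := by ext; simp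
  rw [this, Finset.card_compl, Fintype.card_fin]

theorem sum_marginal {n : ℕ} (p : (Fin n → Bool) → ℝ) (T : Finset (Fin n)) :
    ∑ x, marginal p T x = 2 ^ (n - T.card) * ∑ x, p x := by
  simp only [marginal, Finset.sum_filter]
  rw [Finset.sum_comm, Finset.mul_sum]
  refine Finset.sum_congr rfl fun y _ => ?_
  rw [← Finset.sum_filter, Finset.sum_const, nsmul_eq_mul]
  have : (Finset.univ.filter fun x : Fin n → Bool => ∀ i ∈ T, y i = x i) =
      Finset.univ.filter fun x : Fin n → Bool => ∀ i ∈ T, x i = y i := by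
    simp only [eq_comm]
  rw [this, card_filter_agree]
  push_cast
  rfl

theorem two_pow_card_mul {n : ℕ} (T : Finset (Fin n)) :
    (2 : ℝ) ^ T.card * 2 ^ (n - T.card) = 2 ^ n := by
  rw [← pow_add, Nat.add_sub_cancel' (by simpa using Finset.card_le_univ T)]

theorem H₂_eq (x : ℝ) : H₂ x = binEntropy x / log 2 := by
  simp only [H₂, logb, binEntropy_eq_negMulLog_add_negMulLog_one_sub, negMulLog]
  ring

theorem exists_binEntropy_eq {u : ℝ} (hu : u ∈ Icc (0 : ℝ) 1) :
    ∃ s ∈ Icc (0 : ℝ) (1 / 2), binEntropy s = u * log 2 := by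
  have hlog := log_pos one_lt_two
  have h := intermediate_value_Icc (a := (0 : ℝ)) (b := 1 / 2) (by norm_num)
    binEntropy_continuous.continuousOn
  have h2 : binEntropy (1 / 2) = log 2 := by
    rw [one_div, binEntropy_two_inv]
  rw [binEntropy_zero, h2] at h
  obtain ⟨s, hs, hs'⟩ := h ⟨mul_nonneg hu.1 hlog.le, mul_le_of_le_one_left hlog.le hu.2⟩
  exact ⟨s, hs, hs'⟩

/-- The intermediate value theorem supplies a preimage, so `invFunOn` does not return its default
value. Uniqueness of the preimage plays no role. -/
theorem H₂inv_spec {u : ℝ} (hu : u ∈ Icc (0 : ℝ) 1) :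
    H₂inv u ∈ Icc (0 : ℝ) (1 / 2) ∧ binEntropy (H₂inv u) = u * log 2 := by
  have hlog := log_pos one_lt_two
  have hex : ∃ s ∈ Icc (0 : ℝ) (1 / 2), H₂ s = u := by
    obtain ⟨s, hs, h⟩ := exists_binEntropy_eq hu
    exact ⟨s, hs, by rw [H₂_eq, h, mul_div_cancel_right₀ _ hlog.ne']⟩
  refine ⟨Function.invFunOn_mem hex, ?_⟩
  have h := Function.invFunOn_eq hex
  rw [H₂_eq, div_eq_iff hlog.ne'] at h
  exact h

theorem Ent_const_mul {n : ℕ} {c : ℝ} (hc : 0 < c) (q : (Fin n → Bool) → ℝ)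
    (hsum : c * ∑ x, q x = 2 ^ n) :
    Ent (fun x => c * q x) = logb 2 c - c / 2 ^ n * (∑ x, negMulLog (q x)) / log 2 := by
  have hcard : (Fintype.card (Fin n → Bool) : ℝ) = 2 ^ n := by simp
  have hE : (𝔼 x, c * q x) = 1 := by
    rw [Fintype.expect_eq_sum_div_card, hcard, ← Finset.mul_sum, hsum]
    exact div_self (by positivity)
  unfold Ent
  rw [hE, logb_one, mul_zero, sub_zero, Fintype.expect_eq_sum_div_card, hcard]
  have h : ∀ x, c * q x * logb 2 (c * q x) = c / log 2 * (log c * q x - negMulLog (q x)) := by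
    intro x
    -- The logarithm of the product splits only where `q x ≠ 0`; elsewhere both sides vanish.
    rcases eq_or_ne (q x) 0 with h0 | h0
    · simp [h0]
    · rw [logb, log_mul hc.ne' h0, negMulLog]
      ring
  simp only [h]
  rw [← Finset.mul_sum, Finset.sum_sub_distrib, ← Finset.mul_sum]
  have hs : ∑ x, q x = 2 ^ n / c := by rw [← hsum]; field_simp
  have hlog := (log_pos one_lt_two).ne'
  rw [hs, logb]
  field_simp

theorem Ent_noise {n : ℕ} (ε : ℝ) (p : (Fin n → Bool) → ℝ) (hsum : ∑ x, p x = 1) :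
    Ent (noise ε (fun x => 2 ^ n * p x)) = n - noisyEntropy ε p / log 2 := by
  have h : noise ε (fun x => 2 ^ n * p x) = fun x => 2 ^ n * noise ε p x := by
    ext x
    simp only [noise]
    rw [Finset.mul_sum]
    exact Finset.sum_congr rfl fun y _ => by ring
  rw [h, Ent_const_mul (by positivity) _ (by rw [sum_noise, hsum, mul_one]),
    div_self (by positivity), one_mul, logb_pow, logb_self_eq_one one_lt_two, mul_one]
  rfl

theorem condEnt_eq {n : ℕ} (p : (Fin n → Bool) → ℝ) (hsum : ∑ x, p x = 1) (T : Finset (Fin n)) :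
    condEnt (fun x => 2 ^ n * p x) T = T.card - marginalEntropy p T / log 2 := by
  have h : condExpect (fun x => 2 ^ n * p x) T = fun x => 2 ^ T.card * marginal p T x := by
    ext x
    rw [condExpect, Finset.expect_eq_sum_div_card, card_filter_agree, ← Finset.mul_sum,
      ← two_pow_card_mul T, marginal]
    push_cast
    field_simp
  rw [condEnt, h, Ent_const_mul (by positivity) _
    (by rw [sum_marginal, hsum, mul_one, two_pow_card_mul]), logb_pow,
    logb_self_eq_one one_lt_two, mul_one, marginalEntropy]

/-- For a density with respect to the uniform measure, `condEnt` at `T` is the deficit of the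
marginal entropy from its maximum `T.card` bits, and the mean size of `T` is `l * n`. -/
theorem expectSubset_condEnt {n : ℕ} (l : ℝ) (p : (Fin n → Bool) → ℝ) (hsum : ∑ x, p x = 1) :
    expectSubset l (fun T => condEnt (fun x => 2 ^ n * p x) T) =
      l * n - erasureEntropy l p / log 2 := by
  have h : ∀ T, condEnt (fun x => 2 ^ n * p x) T =
      (T.card : ℝ) + (-(1 / log 2)) * marginalEntropy p T := by
    intro T
    rw [condEnt_eq p hsum]
    ring
  simp only [h]
  rw [expectSubset_add, expectSubset_const_mul, expectSubset_card, erasureEntropy]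
  ring

theorem twoPoint_eq (s : ℝ) :
    twoPoint s = fun x => 2 ^ 1 * (if x 0 = false then s / 2 else 1 - s / 2) := by
  ext x
  unfold twoPoint
  split_ifs <;> ring

theorem sum_cube_one (F : (Fin 1 → Bool) → ℝ) :
    ∑ x, F x = F (Fin.cons false fun _ => false) + F (Fin.cons true fun _ => false) := by
  rw [sum_cube_succ, sum_cube_zero, sum_cube_zero]
  rfl

theorem Ent_twoPoint (s : ℝ) : Ent (twoPoint s) = 1 - binEntropy (s / 2) / log 2 := by
  rw [twoPoint_eq, Ent_const_mul (by positivity) _ (by rw [sum_cube_one]; simp), sum_cube_one,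
    binEntropy_eq_negMulLog_add_negMulLog_one_sub]
  simp

theorem Ent_noise_twoPoint (ε s : ℝ) :
    Ent (noise ε (twoPoint s)) = 1 - binEntropy (ε + (1 - 2 * ε) * (s / 2)) / log 2 := by
  rw [twoPoint_eq, Ent_noise _ _ (by rw [sum_cube_one]; simp), noisyEntropy_succ,
    noisyEntropy_zero, noisyEntropy_zero, add_comm (negMulLog _),
    ← binEntropy_one_sub, binEntropy_eq_negMulLog_add_negMulLog_one_sub]
  simp only [slice, Pi.add_apply, Pi.smul_apply, smul_eq_mul, Fin.cons_zero, Nat.cast_one, if_true,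
    reduceCtorEq, if_false]
  ring_nf

theorem exists_phi_eq {x : ℝ} (hx : x ∈ Icc (0 : ℝ) 1) (ε : ℝ) :
    ∃ s ∈ Icc (0 : ℝ) (1 / 2), binEntropy s = (1 - x) * log 2 ∧
      phi x ε = 1 - binEntropy (ε + (1 - 2 * ε) * s) / log 2 := by
  have hlog := log_pos one_lt_two
  have hex : ∃ s ∈ Icc (0 : ℝ) 1, Ent (twoPoint s) = x := by
    obtain ⟨s, hs, h⟩ := exists_binEntropy_eq (u := 1 - x) ⟨by linarith [hx.2], by linarith [hx.1]⟩
    refine ⟨2 * s, ⟨by linarith [hs.1], by linarith [hs.2]⟩, ?_⟩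
    rw [Ent_twoPoint, mul_div_cancel_left₀ _ two_ne_zero, h, mul_div_cancel_right₀ _ hlog.ne']
    ring
  have hmem : twoPointParam x ∈ Icc (0 : ℝ) 1 := Function.invFunOn_mem hex
  have heq : Ent (twoPoint (twoPointParam x)) = x := Function.invFunOn_eq hex
  refine ⟨twoPointParam x / 2, ⟨by linarith [hmem.1], by linarith [hmem.2]⟩, ?_,
    Ent_noise_twoPoint ε _⟩
  rw [Ent_twoPoint] at heq
  rw [show 1 - x = binEntropy (twoPointParam x / 2) / log 2 by linarith,
    div_mul_cancel₀ _ hlog.ne']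

/-- When `t = 0` the bounds force `A = 0`, so the convention for `0/0` is harmless and multiplying
back by `t` still recovers the numerator. -/
theorem div_div_mem_Icc {A t : ℝ} (hA : A ∈ Icc 0 (t * log 2)) (ht : 0 ≤ t) :
    A / log 2 / t ∈ Icc (0 : ℝ) 1 ∧ A / log 2 / t * t = A / log 2 := by
  have hlog := log_pos one_lt_two
  rcases ht.eq_or_lt with h | h
  · subst h
    have : A = 0 := le_antisymm (by simpa using hA.2) hA.1
    simp [this]
  · refine ⟨⟨div_nonneg (div_nonneg hA.1 hlog.le) ht, ?_⟩, div_mul_cancel₀ _ h.ne'⟩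
    rw [div_le_one h, div_le_iff₀ hlog]
    exact hA.2

/-! ### Laws of random vectors -/

theorem shannonEntropy_eq {Ω α : Type*} [MeasurableSpace Ω] [Fintype α]
    (μ : MeasureTheory.Measure Ω) (Y : Ω → α) :
    shannonEntropy μ Y = (∑ a, negMulLog (μ.real (Y ⁻¹' {a}))) / log 2 := by
  rw [shannonEntropy, ← Finset.sum_neg_distrib, Finset.sum_div]
  refine Finset.sum_congr rfl fun a _ => ?_
  rw [logb, negMulLog]
  ring

section Law

open MeasureTheory ProbabilityTheory

variable {Ω : Type*} [MeasurableSpace Ω] {μ : Measure Ω} [IsProbabilityMeasure μ] {n : ℕ}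
  {X Z : Ω → Fin n → Bool}

theorem sum_law (hX : Measurable X) : ∑ x, μ.real (X ⁻¹' {x}) = 1 := by
  rw [sum_measureReal_preimage_singleton _ fun y _ => hX (measurableSet_singleton y)]
  simp

theorem law_restrict (hX : Measurable X) (T : Finset (Fin n)) (x : Fin n → Bool) :
    μ.real ((fun ω (i : T) => X ω i.1) ⁻¹' {fun i : T => x i.1}) =
      marginal (fun x => μ.real (X ⁻¹' {x})) T x := by
  rw [marginal, sum_measureReal_preimage_singleton _ fun y _ => hX (measurableSet_singleton y)]
  congr 1
  ext ω
  simp [funext_iff]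

theorem shannonEntropy_restrict (hX : Measurable X) (T : Finset (Fin n)) :
    shannonEntropy μ (fun ω (i : T) => X ω i.1) =
      marginalEntropy (fun x => μ.real (X ⁻¹' {x})) T / log 2 := by
  rw [shannonEntropy_eq, marginalEntropy]
  congr 1
  have h : ∑ x, negMulLog (marginal (fun x => μ.real (X ⁻¹' {x})) T x) =
      ∑ z : T → Bool, 2 ^ (n - T.card) *
        negMulLog (μ.real ((fun ω (i : T) => X ω i.1) ⁻¹' {z})) := by
    rw [← Finset.sum_fiberwise Finset.univ (fun (x : Fin n → Bool) (i : T) => x i.1)]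
    refine Finset.sum_congr rfl fun z _ => ?_
    -- An arbitrary extension of `z` to the whole cube, which turns the fibre over `z` into a set
    -- counted by `card_filter_agree`.
    let x₀ : Fin n → Bool := fun i => if hi : i ∈ T then z ⟨i, hi⟩ else false
    have hx₀ : (fun i : T => x₀ i.1) = z := by
      ext i
      simp [x₀]
    have hf : (Finset.univ.filter fun x : Fin n → Bool => (fun i : T => x i.1) = z) =
        Finset.univ.filter fun x : Fin n → Bool => ∀ i ∈ T, x i = x₀ i := by
      ext x
      rw [← hx₀]
      simp [funext_iff]
    have hc : ∀ x ∈ Finset.univ.filter fun x : Fin n → Bool => (fun i : T => x i.1) = z,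
        negMulLog (marginal (fun x => μ.real (X ⁻¹' {x})) T x) =
          negMulLog (μ.real ((fun ω (i : T) => X ω i.1) ⁻¹' {z})) := by
      intro x hx
      rw [← law_restrict hX, (Finset.mem_filter.1 hx).2]
    rw [Finset.sum_congr rfl hc, Finset.sum_const, hf, card_filter_agree, nsmul_eq_mul]
    push_cast
    rfl
  rw [h, ← Finset.mul_sum, ← mul_assoc, div_mul_eq_mul_div, two_pow_card_mul,
    div_self (by positivity), one_mul]

theorem expectSubset_shannonEntropy (hX : Measurable X) (l : ℝ) :
    expectSubset l (fun T => shannonEntropy μ (fun ω (i : T) => X ω i.1)) =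
      erasureEntropy l (fun x => μ.real (X ⁻¹' {x})) / log 2 := by
  have h : ∀ T : Finset (Fin n), shannonEntropy μ (fun ω (i : T) => X ω i.1) =
      1 / log 2 * marginalEntropy (fun x => μ.real (X ⁻¹' {x})) T := by
    intro T
    rw [shannonEntropy_restrict hX]
    ring
  simp only [h]
  rw [expectSubset_const_mul, erasureEntropy]
  ring

/-- The output is `w` exactly when `(X, Z) = (y, y ⊕ w)` for some `y`. Independence factors each
such probability, and the weight of `y ⊕ w` is the Hamming distance from `y` to `w`. -/
theorem law_xor (hX : Measurable X) (hZ : Measurable Z) (hXZ : IndepFun X Z μ) {ε : ℝ}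
    (hnoise : HasNoiseLaw μ ε Z) (w : Fin n → Bool) :
    μ.real ((fun ω i => xor (X ω i) (Z ω i)) ⁻¹' {w}) =
      noise ε (fun x => μ.real (X ⁻¹' {x})) w := by
  have hinj : Function.Injective
      (fun y : Fin n → Bool => ((y, fun i => xor (y i) (w i)) : (Fin n → Bool) × (Fin n → Bool))) :=
    fun a b h => (Prod.ext_iff.1 h).1
  have hpre : (fun ω i => xor (X ω i) (Z ω i)) ⁻¹' {w} = (fun ω => (X ω, Z ω)) ⁻¹'
      ((Finset.univ.map ⟨_, hinj⟩ : Finset ((Fin n → Bool) × (Fin n → Bool))) :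
        Set ((Fin n → Bool) × (Fin n → Bool))) := by
    ext ω
    simp only [mem_preimage, mem_singleton_iff, Finset.coe_map, Function.Embedding.coeFn_mk,
      Finset.coe_univ, image_univ, mem_range, Prod.mk.injEq, funext_iff]
    constructor
    · intro h
      exact ⟨X ω, fun _ => rfl, fun i => by rw [← h i]; simp⟩
    · rintro ⟨y, hy, hz⟩ i
      rw [← hy i, ← hz i]
      simp
  rw [hpre, ← sum_measureReal_preimage_singleton _
    fun y _ => (hX.prodMk hZ) (measurableSet_singleton y), Finset.sum_map, noise]
  refine Finset.sum_congr rfl fun y _ => ?_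
  have hinter : (fun ω => (X ω, Z ω)) ⁻¹' {(y, fun i => xor (y i) (w i))} =
      X ⁻¹' {y} ∩ Z ⁻¹' {fun i => xor (y i) (w i)} := by
    ext ω
    simp
  have hd : (Finset.univ.filter fun i => xor (y i) (w i) = true).card = hammingDist y w := by
    unfold hammingDist
    congr 1
    ext i
    simp
  have hmul := hXZ.measure_inter_preimage_eq_mul {y} {fun i => xor (y i) (w i)}
    (measurableSet_singleton _) (measurableSet_singleton _)
  have hZ' := hnoise fun i => xor (y i) (w i)
  rw [hd] at hZ'
  simp only [Function.Embedding.coeFn_mk]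
  rw [hinter, measureReal_def, hmul, ENNReal.toReal_mul, ← measureReal_def, ← measureReal_def,
    hZ', mul_comm]

end Law

end NoisyCube

theorem theorem1p12 (n : ℕ) (ε : ℝ) (hε0 : 0 < ε) (hε1 : ε < 1) (l t : ℝ)
    (hl : l = (1 - 2 * ε) ^ 2) (ht : t = (1 - 2 * ε) ^ 2 * n) :
    (∀ f : (Fin n → Bool) → ℝ, (∀ x, 0 ≤ f x) → (𝔼 x, f x) = 1 →
      NoisyCube.expectSubset l (fun T => NoisyCube.condEnt f T) / t ∈ Set.Icc (0 : ℝ) 1 ∧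
      NoisyCube.Ent (NoisyCube.noise ε f) ≤
        n * NoisyCube.phi
          (NoisyCube.expectSubset l (fun T => NoisyCube.condEnt f T) / t) ε) ∧
    (∀ {Ω : Type*} [MeasurableSpace Ω] (μ : MeasureTheory.Measure Ω)
      [MeasureTheory.IsProbabilityMeasure μ] (X Z : Ω → Fin n → Bool),
      Measurable X → Measurable Z → ProbabilityTheory.IndepFun X Z μ →
      NoisyCube.HasNoiseLaw μ ε Z →
      NoisyCube.expectSubset l
          (fun T => NoisyCube.shannonEntropy μ (fun ω (i : T) => X ω i.1)) / t ∈
        Set.Icc (0 : ℝ) 1 ∧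
      n * NoisyCube.H₂ (ε + (1 - 2 * ε) * NoisyCube.H₂inv
          (NoisyCube.expectSubset l
            (fun T => NoisyCube.shannonEntropy μ (fun ω (i : T) => X ω i.1)) / t)) ≤
        NoisyCube.shannonEntropy μ (fun ω i => xor (X ω i) (Z ω i))) := by
  have htl : t = l * n := by rw [ht, hl]
  have ht0 : 0 ≤ t := by rw [ht]; positivity
  have hlog := Real.log_pos one_lt_two
  refine ⟨fun f hf hmean => ?_, fun {Ω} _ μ _ X Z hX hZ hXZ hnoise => ?_⟩
  · obtain ⟨p, hp⟩ : ∃ p : (Fin n → Bool) → ℝ, p = fun x => f x / 2 ^ n := ⟨_, rfl⟩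
    have hfp : f = fun x => 2 ^ n * p x := by
      ext x
      rw [hp]
      field_simp
    have hp0 : 0 ≤ p := fun x => by
      rw [hp]
      exact div_nonneg (hf x) (by positivity)
    have hsum : ∑ x, p x = 1 := by
      rw [Fintype.expect_eq_sum_div_card, Finset.sum_div] at hmean
      rw [hp]
      simpa using hmean
    have hA := NoisyCube.erasureEntropy_mem hε0 hε1 hp0 hsum
    rw [← ht, ← hl] at hA
    obtain ⟨hI, hmul⟩ := NoisyCube.div_div_mem_Icc
      -- The functional side measures the deficit of the erasure entropy from its maximum `t * log
      -- 2`, and this deficit lies in the same interval.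
      (A := t * Real.log 2 - NoisyCube.erasureEntropy l p)
      ⟨by linarith [hA.2], by linarith [hA.1]⟩ ht0
    have hE : NoisyCube.expectSubset l (fun T => NoisyCube.condEnt f T) =
        (t * Real.log 2 - NoisyCube.erasureEntropy l p) / Real.log 2 := by
      rw [hfp, NoisyCube.expectSubset_condEnt l p hsum, ht, hl]
      field_simp
    rw [hE]
    refine ⟨hI, ?_⟩
    obtain ⟨s, hs, hs1, hs2⟩ := NoisyCube.exists_phi_eq hI ε
    have hmul' : NoisyCube.erasureEntropy l p = t * Real.binEntropy s := by
      rw [hs1]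
      have := (eq_div_iff hlog.ne').1 hmul
      linarith
    have h := NoisyCube.noisyEntropy_ge hε0 hε1 hp0 hsum hs (by rw [← hl, ← htl, hmul'])
    rw [hs2, hfp, NoisyCube.Ent_noise ε p hsum, mul_sub, mul_one, ← mul_div_assoc]
    exact sub_le_sub_left (div_le_div_of_nonneg_right h hlog.le) _
  · have hp0 : (0 : (Fin n → Bool) → ℝ) ≤ fun x => μ.real (X ⁻¹' {x}) :=
      fun x => MeasureTheory.measureReal_nonneg
    have hsum := NoisyCube.sum_law (μ := μ) hX
    have hA := NoisyCube.erasureEntropy_mem hε0 hε1 hp0 hsum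
    rw [← ht, ← hl] at hA
    obtain ⟨hI, hmul⟩ := NoisyCube.div_div_mem_Icc hA ht0
    rw [NoisyCube.expectSubset_shannonEntropy hX]
    refine ⟨hI, ?_⟩
    obtain ⟨hs, hs1⟩ := NoisyCube.H₂inv_spec hI
    have h := NoisyCube.noisyEntropy_ge hε0 hε1 hp0 hsum hs (by
      rw [← hl, ← htl, hs1]
      have := (eq_div_iff hlog.ne').1 hmul
      linarith)
    rw [NoisyCube.H₂_eq, NoisyCube.shannonEntropy_eq, ← mul_div_assoc]
    simp only [NoisyCube.law_xor hX hZ hXZ hnoise]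
    exact div_le_div_of_nonneg_right h hlog.le
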